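/- A lattice polytope $\mathcal{P}\subseteq\mathbb{R}^n$ is \emph{reflexive} if for some $u\in\mathbb{Z}^n$ the translate $\mathcal{P}'=\mathcal{P}-u$ has $0$ in its interior and its polar dual $\{y\in\mathbb{R}^n : x\cdot y\le 1 \text{ for all } x\in\mathcal{P}'\}$ is again a lattice polytope. It is \emph{integrally closed} if for every integer $m\ge 1$ each $x\in m\mathcal{P}\cap\mathbb{Z}^n$ is a sum of $m$ points of $\mathcal{P}\cap\mathbb{Z}^n$. For $d=\dim\mathcal{P}$, its $h^*$-vector $h^*(\mathcal{P})=(h_0^*,\dots,h_d^*)$ is defined by $$1+\sum_{m\ge 1}|m\mathcal{P}\cap\mathbb{Z}^n|\,t^m=\frac{\sum_{j=0}^d h_j^*t^j}{(1-t)^{d+1}},$$ and it is \emph{unimodal} if $h_0^*\le\cdots\le h_k^*\ge\cdots\ge h_d^*$ for some $0\le k\le d$. Let $\mathcal{P}\subseteq\mathbb{R}^n$ and $\mathcal{Q}\subseteq\mathbb{R}^m$ be integrally closed reflexive simplices with $0$ in the interior of $\mathcal{P}$, and let $v_0,\dots,v_m$ be the vertices of $\mathcal{Q}$. Then for each $i=0,\dots,m$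 the polytope $$\mathcal{P}*_i\mathcal{Q}:=\operatorname{conv}\bigl((\mathcal{P}\times 0^m)\cup(0^n\times(\mathcal{Q}-v_i))\bigr)\subseteq\mathbb{R}^{n+m}$$ is an integrally closed reflexive simplex. If, in addition, $h^*(\mathcal{P})$ and $h^*(\mathcal{Q})$ are unimodal, then $h^*(\mathcal{P}*_i\mathcal{Q})$ is unimodal. -/

import Mathlib

open scoped Pointwise

noncomputable section

namespace LatticePolytope

/-- The inclusion `ℤ^ι ⊆ ℝ^ι`. -/
def toReal {ι : Type*} (x : ι → ℤ) : ι → ℝ := fun i => (x i : ℝ)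

/-- A lattice polytope: the convex hull of a nonempty finite set of lattice points. -/
def IsLatticePolytope {ι : Type*} (P : Set (ι → ℝ)) : Prop :=
  ∃ s : Set (ι → ℤ), s.Finite ∧ s.Nonempty ∧ P = convexHull ℝ (toReal '' s)

/-- A simplex: the convex hull of a nonempty finite affinely independent family of points. -/
def IsSimplex {ι : Type*} (P : Set (ι → ℝ)) : Prop :=
  ∃ (k : ℕ) (v : Fin (k + 1) → ι → ℝ),
    AffineIndependent ℝ v ∧ P = convexHull ℝ (Set.range v)

/-- The translate `P - v`. -/
def translate {ι : Type*} (P : Set (ι → ℝ)) (v : ι → ℝ) : Set (ι → ℝ) :=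
  (fun x => x - v) '' P

/-- The polar dual `{y : x ⬝ y ≤ 1 for all x ∈ P}`. -/
def polarDual {ι : Type*} [Fintype ι] (P : Set (ι → ℝ)) : Set (ι → ℝ) :=
  {y | ∀ x ∈ P, x ⬝ᵥ y ≤ 1}

/-- A lattice polytope some lattice translate of which has `0` in its interior and has
a lattice polytope as its polar dual. -/
def IsReflexive {ι : Type*} [Fintype ι] (P : Set (ι → ℝ)) : Prop :=
  IsLatticePolytope P ∧
    ∃ u : ι → ℤ, 0 ∈ interior (translate P (toReal u)) ∧
      IsLatticePolytope (polarDual (translate P (toReal u)))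

/-- Every lattice point of the dilate `m P` is a sum of `m` lattice points of `P`. -/
def IsIntegrallyClosed {ι : Type*} (P : Set (ι → ℝ)) : Prop :=
  IsLatticePolytope P ∧
    ∀ m : ℕ, 0 < m → ∀ x : ι → ℤ, toReal x ∈ (m : ℝ) • P →
      ∃ y : Fin m → ι → ℤ, (∀ j, toReal (y j) ∈ P) ∧ x = ∑ j, y j

/-- The dimension of (the affine span of) `P`. -/
def dim {ι : Type*} (P : Set (ι → ℝ)) : ℕ := Module.finrank ℝ (vectorSpan ℝ P)

/-- The Ehrhart series `1 + ∑_{m ≥ 1} |m P ∩ ℤ^ι| t^m`. -/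
def ehrhartSeries {ι : Type*} (P : Set (ι → ℝ)) : PowerSeries ℤ :=
  PowerSeries.mk fun m =>
    if m = 0 then 1 else (Set.ncard {x : ι → ℤ | toReal x ∈ (m : ℝ) • P} : ℤ)

/-- The entry `h*_j` of the `h*`-vector: the coefficient of `t^j` in
`(1 - t)^(d + 1) E_P(t)`, with `d = dim P`; the `h*`-vector consists of the entries
with `0 ≤ j ≤ d`. -/
def hStar {ι : Type*} (P : Set (ι → ℝ)) (j : ℕ) : ℤ :=
  PowerSeries.coeff j ((1 - PowerSeries.X) ^ (dim P + 1) * ehrhartSeries P)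

/-- `h*_0 ≤ ⋯ ≤ h*_k ≥ ⋯ ≥ h*_d` for some `k`, where `d = dim P`. -/
def HStarUnimodal {ι : Type*} (P : Set (ι → ℝ)) : Prop :=
  ∃ k ≤ dim P, (∀ j < k, hStar P j ≤ hStar P (j + 1)) ∧
    ∀ j, k ≤ j → j < dim P → hStar P (j + 1) ≤ hStar P j

/-- For a vertex `v` of `Q`, the polytope `conv ((P × 0) ∪ (0 × (Q - v)))` in
`ℝ^ι × ℝ^κ = ℝ^(ι ⊕ κ)`. -/
def star {ι κ : Type*} (P : Set (ι → ℝ)) (Q : Set (κ → ℝ)) (v : κ → ℝ) :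
    Set (ι ⊕ κ → ℝ) :=
  convexHull ℝ (((fun x => Sum.elim x 0) '' P) ∪ ((fun y => Sum.elim 0 y) '' translate Q v))

end LatticePolytope

end

/-!
The polytope `P *ᵢ Q` is the free sum of `P` and `Q - vᵢ`, which meet in the origin. As the polar
dual of `P` is a lattice polytope, the gauge of `P` takes integer values on lattice points. A
lattice point `(x, y)` therefore lies in the `m`-th dilate of the free sum if and only if `y` lies
in the dilate of `Q - vᵢ` by the nonnegative integer `m - gauge P x`. This gives the integral
closedness and, on counting lattice points, `h*(P *ᵢ Q) = h*(P) h*(Q)` for the `h*`-polynomials.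
If `Q - u` is the translate of `Q` centred at the origin, then the free sum is centred at
`(0, u - vᵢ)`, and the polar dual of its centred translate is the convex hull of the points
`((1 - (vᵢ - u) ⬝ b) a, b)`, where `a` and `b` run through lattice points spanning the polar duals
of `P` and `Q - u`.

The `h*`-vector of a simplex counts the lattice points in a half-open parallelepiped by height. If
the simplex is reflexive, then `x ↦ p - x`, with `p` the sum of its vertices, exchanges the points
of heights `j` and `d - j`, so the `h*`-vector is symmetric. It remains to see that a product of
symmetric unimodal polynomials with nonnegative coefficients is symmetric and unimodal.
-/

namespace LatticePolytope

open Finset.HasAntidiagonal (antidiagonal mem_antidiagonal)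

section Lattice

variable {ι κ : Type*}

lemma toReal_zero : toReal (0 : ι → ℤ) = 0 := by
  ext
  exact Int.cast_zero

lemma toReal_add (x y : ι → ℤ) : toReal (x + y) = toReal x + toReal y := by
  ext i
  exact Int.cast_add _ _

lemma toReal_neg (x : ι → ℤ) : toReal (-x) = -toReal x := by
  ext i
  exact Int.cast_neg _

lemma toReal_sub (x y : ι → ℤ) : toReal (x - y) = toReal x - toReal y := by
  ext i
  exact Int.cast_sub _ _

lemma toReal_smul (n : ℤ) (x : ι → ℤ) : toReal (n • x) = (n : ℝ) • toReal x := by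
  ext i
  exact Int.cast_mul _ _

lemma toReal_sumElim (x : ι → ℤ) (y : κ → ℤ) :
    toReal (Sum.elim x y) = Sum.elim (toReal x) (toReal y) :=
  Sum.comp_elim _ x y

lemma toReal_dotProduct [Fintype ι] (x y : ι → ℤ) :
    toReal x ⬝ᵥ toReal y = ((x ⬝ᵥ y : ℤ) : ℝ) := by
  simp only [dotProduct, toReal, Int.cast_sum, Int.cast_mul]

lemma isClosedEmbedding_toReal [Finite ι] : Topology.IsClosedEmbedding (toReal (ι := ι)) :=
  Topology.IsClosedEmbedding.piMap fun _ => Int.isClosedEmbedding_coe_real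

lemma toReal_injective : Function.Injective (toReal (ι := ι)) := fun _ _ h =>
  funext fun i => Int.cast_injective (congrFun h i)

lemma finite_toReal_preimage [Finite ι] {K : Set (ι → ℝ)} (hK : IsCompact K) :
    (toReal ⁻¹' K).Finite :=
  isCompact_iff_finite.1 (isClosedEmbedding_toReal.isCompact_preimage hK)

variable {P : Set (ι → ℝ)}

lemma IsLatticePolytope.convex (hP : IsLatticePolytope P) : Convex ℝ P := by
  obtain ⟨s, -, -, rfl⟩ := hP
  exact convex_convexHull ℝ _

lemma IsLatticePolytope.isCompact [Finite ι] (hP : IsLatticePolytope P) : IsCompact P := by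
  obtain ⟨s, hs, -, rfl⟩ := hP
  exact (hs.image _).isCompact_convexHull ℝ

lemma IsLatticePolytope.exists_eq_toReal_of_mem_extremePoints (hP : IsLatticePolytope P)
    {v : ι → ℝ} (hv : v ∈ P.extremePoints ℝ) : ∃ w : ι → ℤ, toReal w = v := by
  obtain ⟨s, -, -, rfl⟩ := hP
  obtain ⟨w, -, hw⟩ := extremePoints_convexHull_subset hv
  exact ⟨w, hw⟩

end Lattice

section Translate

variable {ι : Type*} {P : Set (ι → ℝ)}

lemma translate_eq_vadd (P : Set (ι → ℝ)) (v : ι → ℝ) : translate P v = -v +ᵥ P :=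
  Set.image_congr fun x _ => sub_eq_neg_add x v

lemma mem_translate_iff {v x : ι → ℝ} : x ∈ translate P v ↔ x + v ∈ P := by
  rw [translate_eq_vadd, Set.mem_vadd_set_iff_neg_vadd_mem, neg_neg, vadd_eq_add, add_comm]

lemma translate_zero : translate P 0 = P := by
  ext x
  rw [mem_translate_iff, add_zero]

lemma translate_translate (u v : ι → ℝ) :
    translate (translate P u) v = translate P (u + v) := by
  ext x
  simp only [mem_translate_iff, add_assoc, add_comm u v]

lemma interior_translate (P : Set (ι → ℝ)) (v : ι → ℝ) :
    interior (translate P v) = translate (interior P) v := by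
  simp only [translate_eq_vadd, interior_vadd]

lemma mem_smul_translate_iff {r : ℝ} {v x : ι → ℝ} :
    x ∈ r • translate P v ↔ x + r • v ∈ r • P := by
  constructor
  · rintro ⟨-, ⟨y, hy, rfl⟩, rfl⟩
    exact ⟨y, hy, by simp only [smul_sub, sub_add_cancel]⟩
  · rintro ⟨y, hy, hyx⟩
    refine ⟨y - v, Set.mem_image_of_mem _ hy, ?_⟩
    simp only at hyx ⊢
    rw [smul_sub, hyx, add_sub_cancel_right]

lemma IsLatticePolytope.translate (hP : IsLatticePolytope P) (w : ι → ℤ) :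
    IsLatticePolytope (translate P (toReal w)) := by
  obtain ⟨s, hs, hne, rfl⟩ := hP
  refine ⟨(· - w) '' s, hs.image _, hne.image _, ?_⟩
  rw [translate_eq_vadd, ← convexHull_vadd, ← translate_eq_vadd, LatticePolytope.translate,
    Set.image_image, Set.image_image]
  simp only [toReal_sub]

lemma IsIntegrallyClosed.translate (hP : IsIntegrallyClosed P) (w : ι → ℤ) :
    IsIntegrallyClosed (translate P (toReal w)) := by
  refine ⟨hP.1.translate w, fun m hm x hx => ?_⟩
  rw [mem_smul_translate_iff, ← Int.cast_natCast (R := ℝ) m, ← toReal_smul, ← toReal_add,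
    Int.cast_natCast] at hx
  obtain ⟨y, hy, hxy⟩ := hP.2 m hm _ hx
  refine ⟨fun j => y j - w, fun j => ?_, ?_⟩
  · rw [mem_translate_iff, ← toReal_add, sub_add_cancel]
    exact hy j
  · rw [Finset.sum_sub_distrib, ← hxy, Finset.sum_const, Finset.card_fin, natCast_zsmul,
      add_sub_cancel_right]

lemma IsSimplex.translate (hP : IsSimplex P) (v : ι → ℝ) : IsSimplex (translate P v) := by
  obtain ⟨k, p, hp, rfl⟩ := hP
  refine ⟨k, -v +ᵥ p, hp.vadd, ?_⟩
  rw [translate_eq_vadd, ← convexHull_vadd, ← Set.image_vadd, ← Set.range_comp]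
  rfl

lemma dim_translate (v : ι → ℝ) : dim (translate P v) = dim P := by
  rw [dim, dim, translate_eq_vadd, ← direction_affineSpan, ← AffineSubspace.pointwise_vadd_span,
    AffineSubspace.pointwise_vadd_direction, direction_affineSpan]

lemma ehrhartSeries_translate (w : ι → ℤ) :
    ehrhartSeries (translate P (toReal w)) = ehrhartSeries P := by
  have image_add (m : ℕ) : (· + (m : ℤ) • w) '' {x | toReal x ∈ (m : ℝ) • translate P (toReal w)} =
      {x | toReal x ∈ (m : ℝ) • P} := by
    rw [Set.image_add_right]
    ext x
    rw [Set.mem_preimage, Set.mem_ofPred_eq, Set.mem_ofPred_eq, ← sub_eq_add_neg, toReal_sub,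
      toReal_smul, Int.cast_natCast, mem_smul_translate_iff, sub_add_cancel]
  simp only [ehrhartSeries, ← image_add, Set.ncard_image_of_injective _ (add_left_injective _)]

lemma hStar_translate (w : ι → ℤ) : hStar (translate P (toReal w)) = hStar P := by
  ext j
  rw [hStar, hStar, dim_translate, ehrhartSeries_translate]

lemma hStarUnimodal_translate_iff (w : ι → ℤ) :
    HStarUnimodal (translate P (toReal w)) ↔ HStarUnimodal P := by
  simp only [HStarUnimodal, hStar_translate, dim_translate]

end Translate

section Gauge

variable {E : Type*} [NormedAddCommGroup E] [NormedSpace ℝ E] {K : Set E}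

lemma gauge_le_iff_mem_smul (hK : Convex ℝ K) (hc : IsCompact K) (h0 : 0 ∈ interior K)
    {r : ℝ} (hr : 0 ≤ r) {x : E} : gauge K x ≤ r ↔ x ∈ r • K := by
  have hnhds : K ∈ nhds 0 := mem_interior_iff_mem_nhds.1 h0
  refine ⟨fun hx => ?_, gauge_le_of_mem hr⟩
  obtain rfl | hr := hr.eq_or_lt
  · have hzero : x = 0 := (gauge_eq_zero (absorbent_nhds_zero hnhds)
      (NormedSpace.isVonNBounded_of_isBounded ℝ hc.isBounded)).1 (hx.antisymm (gauge_nonneg x))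
    rw [hzero]
    exact ⟨0, interior_subset h0, smul_zero _⟩
  · rw [Set.mem_smul_set_iff_inv_smul_mem₀ hr.ne', ← hc.isClosed.closure_eq,
      ← gauge_le_one_iff_mem_closure hK hnhds, gauge_smul_of_nonneg (inv_nonneg.2 hr.le),
      smul_eq_mul, inv_mul_le_one₀ hr]
    exact hx

lemma gauge_lt_of_mem_interior_smul {r : ℝ} (hr : 0 < r) {x : E} (hx : x ∈ interior (r • K)) :
    gauge K x < r := by
  rw [interior_smul₀ hr.ne', Set.mem_smul_set_iff_inv_smul_mem₀ hr.ne'] at hx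
  have := interior_subset_gauge_lt_one _ hx
  rwa [Set.mem_ofPred_eq, gauge_smul_of_nonneg (inv_nonneg.2 hr.le), smul_eq_mul,
    inv_mul_lt_one₀ hr] at this

end Gauge

section Polar

variable {ι : Type*} [Fintype ι] {P : Set (ι → ℝ)}

lemma convex_polarDual (P : Set (ι → ℝ)) : Convex ℝ (polarDual P) :=
  fun _ hy _ hz _ _ hs ht hst x hx =>
    convex_halfSpace_le ⟨dotProduct_add x, fun c => dotProduct_smul c x⟩ 1
      (hy x hx) (hz x hx) hs ht hst

lemma mem_iff_forall_mem_polarDual (hP : Convex ℝ P) (hc : IsClosed P) (h0 : 0 ∈ P)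
    {x : ι → ℝ} : x ∈ P ↔ ∀ y ∈ polarDual P, x ⬝ᵥ y ≤ 1 := by
  classical
  refine ⟨fun hx y hy => hy x hx, fun h => by_contra fun hx => ?_⟩
  obtain ⟨f, u, hlt, hgt⟩ := geometric_hahn_banach_closed_point hP hc hx
  obtain ⟨y, hy⟩ := (dotProductEquiv ℝ ι).surjective f.toLinearMap
  have hf (z : ι → ℝ) : f z = z ⬝ᵥ y := by
    rw [dotProduct_comm]
    exact (LinearMap.congr_fun hy z).symm
  have hu : 0 < u := by simpa only [map_zero] using hlt 0 h0
  have hmem : u⁻¹ • y ∈ polarDual P := fun z hz => by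
    rw [dotProduct_smul, ← hf, smul_eq_mul, inv_mul_le_one₀ hu]
    exact (hlt z hz).le
  have hle := h _ hmem
  rw [dotProduct_smul, ← hf, smul_eq_mul, inv_mul_le_one₀ hu] at hle
  exact hgt.not_ge hle

lemma forall_mem_convexHull_dotProduct_le_iff {S : Set (ι → ℝ)} {x : ι → ℝ} {r : ℝ} :
    (∀ y ∈ convexHull ℝ S, x ⬝ᵥ y ≤ r) ↔ ∀ y ∈ S, x ⬝ᵥ y ≤ r :=
  (convex_halfSpace_le ⟨dotProduct_add x, fun c => dotProduct_smul c x⟩ r).convexHull_subset_iff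

lemma gauge_le_iff_forall_dotProduct_le (hP : Convex ℝ P) (hc : IsClosed P)
    (h0 : 0 ∈ interior P) {S : Set (ι → ℝ)} (hS : polarDual P = convexHull ℝ S) {r : ℝ}
    (hr : 0 ≤ r) {x : ι → ℝ} : gauge P x ≤ r ↔ ∀ y ∈ S, x ⬝ᵥ y ≤ r := by
  have of_pos {s : ℝ} (hs : 0 < s) : gauge P x ≤ s ↔ ∀ y ∈ S, x ⬝ᵥ y ≤ s := by
    rw [← inv_mul_le_one₀ hs, ← smul_eq_mul, ← gauge_smul_of_nonneg (inv_nonneg.2 hs.le),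
      gauge_le_one_iff_mem_closure hP (mem_interior_iff_mem_nhds.1 h0), hc.closure_eq,
      mem_iff_forall_mem_polarDual hP hc (interior_subset h0), hS,
      forall_mem_convexHull_dotProduct_le_iff]
    simp only [smul_dotProduct, smul_eq_mul, inv_mul_le_one₀ hs]
  constructor
  · exact fun h y hy => le_of_forall_pos_le_add fun ε hε =>
      (of_pos (add_pos_of_nonneg_of_pos hr hε)).1 (h.trans (le_add_of_nonneg_right hε.le)) y hy
  · exact fun h => le_of_forall_pos_le_add fun ε hε =>
      (of_pos (add_pos_of_nonneg_of_pos hr hε)).2 fun y hy =>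
        (h y hy).trans (le_add_of_nonneg_right hε.le)

lemma mem_smul_polarDual_of_forall_le (h0 : 0 ∈ interior P) {r : ℝ} (hr : 0 ≤ r) {y : ι → ℝ}
    (h : ∀ x ∈ P, x ⬝ᵥ y ≤ r) : y ∈ r • polarDual P := by
  obtain rfl | hr := hr.eq_or_lt
  · have hy : y = 0 := by
      obtain ⟨c, hc, -, z, hz, hzy⟩ := exists_lt_of_gauge_lt
        (absorbent_nhds_zero (mem_interior_iff_mem_nhds.1 h0)) (lt_add_one (gauge P y))
      have hyy : y ⬝ᵥ y ≤ 0 := by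
        nth_rw 1 [← hzy]
        rw [smul_dotProduct]
        exact smul_nonpos_of_nonneg_of_nonpos hc.le (h z hz)
      exact dotProduct_self_eq_zero.1
        (hyy.antisymm (Finset.sum_nonneg fun i _ => mul_self_nonneg (y i)))
    rw [hy]
    refine ⟨0, fun x _ => ?_, smul_zero _⟩
    rw [dotProduct_zero]
    exact zero_le_one
  · rw [Set.mem_smul_set_iff_inv_smul_mem₀ hr.ne']
    intro x hx
    rw [dotProduct_smul, smul_eq_mul, inv_mul_le_one₀ hr]
    exact h x hx

end Polar

section Reflexive

variable {ι : Type*} [Fintype ι] {P : Set (ι → ℝ)}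

/-- A lattice polytope is reflexive with centre the origin when it can be taken to be its own
translate in the definition of reflexivity. -/
structure IsCenteredReflexive (P : Set (ι → ℝ)) : Prop where
  isLatticePolytope : IsLatticePolytope P
  zero_mem_interior : 0 ∈ interior P
  isLatticePolytope_polarDual : IsLatticePolytope (polarDual P)

lemma IsReflexive.exists_isCenteredReflexive (hP : IsReflexive P) :
    ∃ u : ι → ℤ, IsCenteredReflexive (translate P (toReal u)) :=
  hP.2.imp fun u hu => ⟨hP.1.translate u, hu.1, hu.2⟩

namespace IsCenteredReflexive

lemma zero_mem (hP : IsCenteredReflexive P) : 0 ∈ P :=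
  interior_subset hP.zero_mem_interior

lemma gauge_le_iff (hP : IsCenteredReflexive P) {r : ℝ} (hr : 0 ≤ r) {x : ι → ℝ} :
    gauge P x ≤ r ↔ x ∈ r • P :=
  gauge_le_iff_mem_smul hP.isLatticePolytope.convex hP.isLatticePolytope.isCompact
    hP.zero_mem_interior hr

-- The gauge is the maximum of `0` and of the values of the facet normals, which are integral.
lemma exists_gauge_eq_natCast (hP : IsCenteredReflexive P) (x : ι → ℤ) :
    ∃ n : ℕ, gauge P (toReal x) = n := by
  obtain ⟨B, -, -, hB⟩ := hP.isLatticePolytope_polarDual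
  have le_iff {r : ℝ} (hr : 0 ≤ r) : gauge P (toReal x) ≤ r ↔ ∀ b ∈ B, ((x ⬝ᵥ b : ℤ) : ℝ) ≤ r := by
    simp only [gauge_le_iff_forall_dotProduct_le hP.isLatticePolytope.convex
      hP.isLatticePolytope.isCompact.isClosed hP.zero_mem_interior hB hr, Set.forall_mem_image,
      toReal_dotProduct]
  have hnonneg := gauge_nonneg (s := P) (toReal x)
  refine ⟨⌊gauge P (toReal x)⌋₊, le_antisymm ?_ (Nat.floor_le hnonneg)⟩
  refine (le_iff (Nat.cast_nonneg _)).2 fun b hb => ?_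
  rw [natCast_floor_eq_intCast_floor hnonneg]
  exact Int.cast_le.2 (Int.le_floor.2 ((le_iff hnonneg).1 le_rfl b hb))

lemma mem_smul_of_mem_interior_smul (hP : IsCenteredReflexive P) {n : ℕ} {x : ι → ℤ}
    (hx : toReal x ∈ interior (((n + 1 : ℕ) : ℝ) • P)) : toReal x ∈ (n : ℝ) • P := by
  have hlt := gauge_lt_of_mem_interior_smul (Nat.cast_pos.2 n.succ_pos) hx
  obtain ⟨k, hk⟩ := hP.exists_gauge_eq_natCast x
  rw [← hP.gauge_le_iff n.cast_nonneg]
  rw [hk] at hlt ⊢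
  exact Nat.cast_le.2 (Nat.lt_succ_iff.1 (Nat.cast_lt.1 hlt))

end IsCenteredReflexive

lemma IsReflexive.isCenteredReflexive (hP : IsReflexive P) (h0 : 0 ∈ interior P) :
    IsCenteredReflexive P := by
  obtain ⟨u, hu⟩ := hP.exists_isCenteredReflexive
  have hmem : toReal (-u) ∈ interior (((0 + 1 : ℕ) : ℝ) • translate P (toReal u)) := by
    rwa [zero_add, Nat.cast_one, one_smul, interior_translate, mem_translate_iff, ← toReal_add,
      neg_add_cancel, toReal_zero]
  have := hu.mem_smul_of_mem_interior_smul hmem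
  have hu0 : u = 0 := by
    rw [Nat.cast_zero, Set.zero_smul_set ⟨0, hu.zero_mem⟩, Set.mem_zero, ← toReal_zero] at this
    exact neg_eq_zero.1 (toReal_injective this)
  rwa [hu0, toReal_zero, translate_zero] at hu

end Reflexive

lemma smul_subset_smul_of_le {E : Type*} [AddCommGroup E] [Module ℝ E] {K : Set E}
    (hK : Convex ℝ K) (h0 : 0 ∈ K) {r s : ℝ} (hr : 0 ≤ r) (hrs : r ≤ s) : r • K ⊆ s • K := by
  rw [← add_sub_cancel r s, hK.add_smul hr (sub_nonneg.2 hrs)]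
  exact Set.subset_add_left _ (Set.zero_mem_smul_set h0)

section FreeSum

variable {ι κ : Type*} {P : Set (ι → ℝ)} {Q : Set (κ → ℝ)}

/-- The free sum of `P` and `Q`: the convex hull of their copies in complementary coordinate
subspaces. The polytope `P *_i Q` of the paper is the free sum of `P` and `Q - v_i`. -/
def freeSum (P : Set (ι → ℝ)) (Q : Set (κ → ℝ)) : Set (ι ⊕ κ → ℝ) :=
  convexHull ℝ (((fun x => Sum.elim x 0) '' P) ∪ ((fun y => Sum.elim 0 y) '' Q))

lemma star_eq_freeSum (P : Set (ι → ℝ)) (Q : Set (κ → ℝ)) (v : κ → ℝ) :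
    star P Q v = freeSum P (translate Q v) :=
  rfl

lemma isLinearMap_sumElim_zero_right :
    IsLinearMap ℝ fun x : ι → ℝ => (Sum.elim x 0 : ι ⊕ κ → ℝ) where
  map_add x y := by rw [← Sum.elim_add_add, add_zero]
  map_smul c x := by
    ext (i | _)
    · rfl
    · exact (mul_zero c).symm

lemma isLinearMap_sumElim_zero_left :
    IsLinearMap ℝ fun y : κ → ℝ => (Sum.elim 0 y : ι ⊕ κ → ℝ) where
  map_add x y := by rw [← Sum.elim_add_add, add_zero]
  map_smul c x := by
    ext (_ | j)
    · exact (mul_zero c).symm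
    · rfl

lemma freeSum_convexHull (S : Set (ι → ℝ)) (T : Set (κ → ℝ)) :
    freeSum (convexHull ℝ S) (convexHull ℝ T) =
      convexHull ℝ ((Sum.elim · (0 : κ → ℝ)) '' S ∪ (Sum.elim (0 : ι → ℝ) ·) '' T) := by
  rw [freeSum, isLinearMap_sumElim_zero_right.image_convexHull,
    isLinearMap_sumElim_zero_left.image_convexHull, convexHull_convexHull_union_left,
    convexHull_convexHull_union_right]

lemma IsLatticePolytope.freeSum (hP : IsLatticePolytope P) (hQ : IsLatticePolytope Q) :
    IsLatticePolytope (freeSum P Q) := by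
  obtain ⟨s, hs, hne, rfl⟩ := hP
  obtain ⟨t, ht, -, rfl⟩ := hQ
  refine ⟨(Sum.elim · (0 : κ → ℤ)) '' s ∪ (Sum.elim (0 : ι → ℤ) ·) '' t,
    (hs.image _).union (ht.image _), (hne.image _).inl, ?_⟩
  simp only [freeSum_convexHull, Set.image_union, Set.image_image, toReal_sumElim, toReal_zero]

lemma sumElim_zero_right_mem_freeSum {x : ι → ℝ} (hx : x ∈ P) :
    (Sum.elim x 0 : ι ⊕ κ → ℝ) ∈ freeSum P Q :=
  subset_convexHull ℝ _ (Or.inl (Set.mem_image_of_mem _ hx))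

lemma sumElim_zero_left_mem_freeSum {y : κ → ℝ} (hy : y ∈ Q) :
    (Sum.elim 0 y : ι ⊕ κ → ℝ) ∈ freeSum P Q :=
  subset_convexHull ℝ _ (Or.inr (Set.mem_image_of_mem _ hy))

lemma sumElim_mem_smul_freeSum {s t : ℝ} (hs : 0 ≤ s) (ht : 0 ≤ t) {x : ι → ℝ} {y : κ → ℝ}
    (hx : x ∈ s • P) (hy : y ∈ t • Q) : Sum.elim x y ∈ (s + t) • freeSum P Q := by
  obtain ⟨p, hp, rfl⟩ := hx
  obtain ⟨q, hq, rfl⟩ := hy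
  have hconv : Convex ℝ (freeSum P Q) := convex_convexHull ℝ _
  rw [hconv.add_smul hs ht]
  refine ⟨s • Sum.elim p 0, Set.smul_mem_smul_set (sumElim_zero_right_mem_freeSum hp),
    t • Sum.elim (0 : ι → ℝ) q, Set.smul_mem_smul_set (sumElim_zero_left_mem_freeSum hq), ?_⟩
  simp only [← isLinearMap_sumElim_zero_right.map_smul, ← isLinearMap_sumElim_zero_left.map_smul,
    ← Sum.elim_add_add, add_zero, zero_add]

lemma exists_of_sumElim_mem_smul_freeSum (hP : Convex ℝ P) (hP' : P.Nonempty) (hQ : Convex ℝ Q)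
    (hQ' : Q.Nonempty) {r : ℝ} (hr : 0 ≤ r) {x : ι → ℝ} {y : κ → ℝ}
    (h : Sum.elim x y ∈ r • freeSum P Q) :
    ∃ s t : ℝ, 0 ≤ s ∧ 0 ≤ t ∧ s + t = r ∧ x ∈ s • P ∧ y ∈ t • Q := by
  obtain ⟨z, hz, hrz⟩ := h
  rw [freeSum, (hP.is_linear_image isLinearMap_sumElim_zero_right).convexHull_union
    (hQ.is_linear_image isLinearMap_sumElim_zero_left) (hP'.image _) (hQ'.image _),
    mem_convexJoin] at hz
  obtain ⟨-, ⟨p, hp, rfl⟩, -, ⟨q, hq, rfl⟩, a, b, ha, hb, hab, rfl⟩ := hz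
  refine ⟨r * a, r * b, mul_nonneg hr ha, mul_nonneg hr hb, by rw [← mul_add, hab, mul_one],
    ⟨p, hp, ?_⟩, ⟨q, hq, ?_⟩⟩
  · ext i
    simpa [mul_assoc] using congrFun hrz (Sum.inl i)
  · ext j
    simpa [mul_assoc] using congrFun hrz (Sum.inr j)

lemma exists_one_lt_smul_mem_interior {E : Type*} [TopologicalSpace E] [AddCommGroup E]
    [Module ℝ E] [ContinuousSMul ℝ E] {K : Set E} {x : E} (hx : x ∈ interior K) :
    ∃ s : ℝ, 1 < s ∧ s • x ∈ interior K := by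
  have hs : ∀ᶠ s : ℝ in nhds 1, s • x ∈ interior K :=
    ((continuous_id.smul continuous_const).tendsto' 1 x (one_smul ℝ x)).eventually_mem
      (isOpen_interior.mem_nhds hx)
  have hgt : ∀ᶠ s : ℝ in nhdsWithin 1 (Set.Ioi 1), 1 < s := self_mem_nhdsWithin
  exact (hgt.and (hs.filter_mono nhdsWithin_le_nhds)).exists

lemma sumElim_zero_mem_interior_freeSum (h0 : 0 ∈ interior P) {w : κ → ℝ}
    (hw : w ∈ interior Q) : (Sum.elim 0 w : ι ⊕ κ → ℝ) ∈ interior (freeSum P Q) := by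
  obtain ⟨s, hs, hsw⟩ := exists_one_lt_smul_mem_interior hw
  have hs0 : 0 < s := one_pos.trans hs
  have ht : 0 < 1 - s⁻¹ := sub_pos.2 (inv_lt_one_of_one_lt₀ hs)
  let U : Set (ι ⊕ κ → ℝ) :=
    {z | z ∘ Sum.inl ∈ (1 - s⁻¹) • interior P ∧ z ∘ Sum.inr ∈ s⁻¹ • interior Q}
  refine mem_interior.2 ⟨U, ?_, ?_, Set.zero_mem_smul_set h0, s • w, hsw, inv_smul_smul₀ hs0.ne' w⟩
  · rintro z ⟨hz₁, hz₂⟩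
    rw [← one_smul ℝ (freeSum P Q), ← sub_add_cancel 1 s⁻¹, ← Sum.elim_comp_inl_inr z]
    exact sumElim_mem_smul_freeSum ht.le (inv_pos.2 hs0).le
      (Set.smul_set_mono interior_subset hz₁) (Set.smul_set_mono interior_subset hz₂)
  · exact ((isOpen_interior.smul₀ ht.ne').preimage (by fun_prop)).inter
      ((isOpen_interior.smul₀ (inv_pos.2 hs0).ne').preimage (by fun_prop))

end FreeSum

section LatticeFreeSum

variable {ι κ : Type*} [Fintype ι] {P : Set (ι → ℝ)} {Q : Set (κ → ℝ)}

lemma IsCenteredReflexive.sumElim_mem_smul_freeSum_iff (hP : IsCenteredReflexive P)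
    (hQ : Convex ℝ Q) (h0 : 0 ∈ Q) {x : ι → ℤ} {n : ℕ} (hn : gauge P (toReal x) = n)
    {y : κ → ℝ} {m : ℕ} :
    Sum.elim (toReal x) y ∈ (m : ℝ) • freeSum P Q ↔ ∃ k : ℕ, n + k = m ∧ y ∈ (k : ℝ) • Q := by
  constructor
  · intro h
    obtain ⟨s, t, hs, ht, hst, hx, hy⟩ := exists_of_sumElim_mem_smul_freeSum
      hP.isLatticePolytope.convex ⟨0, hP.zero_mem⟩ hQ ⟨0, h0⟩ m.cast_nonneg h
    have hns : n ≤ s := hn ▸ (hP.gauge_le_iff hs).2 hx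
    have hnm : n ≤ m := Nat.cast_le.1 (hns.trans (hst ▸ le_add_of_nonneg_right ht))
    refine ⟨m - n, Nat.add_sub_cancel' hnm, smul_subset_smul_of_le hQ h0 ht ?_ hy⟩
    rw [Nat.cast_sub hnm]
    linarith
  · rintro ⟨k, rfl, hy⟩
    rw [Nat.cast_add]
    exact sumElim_mem_smul_freeSum n.cast_nonneg k.cast_nonneg
      ((hP.gauge_le_iff n.cast_nonneg).1 hn.le) hy

lemma IsIntegrallyClosed.exists_eq_sum {ι : Type*} {P : Set (ι → ℝ)} (hP : IsIntegrallyClosed P)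
    {m : ℕ} {x : ι → ℤ} (hx : toReal x ∈ (m : ℝ) • P) :
    ∃ y : Fin m → ι → ℤ, (∀ j, toReal (y j) ∈ P) ∧ x = ∑ j, y j := by
  obtain rfl | hm := m.eq_zero_or_pos
  · rw [Nat.cast_zero] at hx
    refine ⟨0, fun j => j.elim0, toReal_injective ?_⟩
    rw [Fin.sum_univ_zero, toReal_zero]
    exact Set.zero_smul_set_subset _ hx
  · exact hP.2 m hm x hx

lemma IsCenteredReflexive.isIntegrallyClosed_freeSum (hP : IsCenteredReflexive P) (h0 : 0 ∈ Q)
    (hPc : IsIntegrallyClosed P) (hQc : IsIntegrallyClosed Q) :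
    IsIntegrallyClosed (freeSum P Q) := by
  refine ⟨hPc.1.freeSum hQc.1, fun m _ z hz => ?_⟩
  obtain ⟨n, hn⟩ := hP.exists_gauge_eq_natCast (z ∘ Sum.inl)
  rw [← Sum.elim_comp_inl_inr z, toReal_sumElim,
    hP.sumElim_mem_smul_freeSum_iff hQc.1.convex h0 hn] at hz
  obtain ⟨k, rfl, hy⟩ := hz
  obtain ⟨x, hx, hxz⟩ := hPc.exists_eq_sum ((hP.gauge_le_iff n.cast_nonneg).1 hn.le)
  obtain ⟨y, hy, hyz⟩ := hQc.exists_eq_sum hy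
  refine ⟨Fin.append (fun j => Sum.elim (x j) 0) (fun j => Sum.elim 0 (y j)), fun j => ?_, ?_⟩
  · refine Fin.addCases (fun i => ?_) (fun i => ?_) j
    · rw [Fin.append_left, toReal_sumElim, toReal_zero]
      exact sumElim_zero_right_mem_freeSum (hx i)
    · rw [Fin.append_right, toReal_sumElim, toReal_zero]
      exact sumElim_zero_left_mem_freeSum (hy i)
  · rw [Fin.sum_univ_add]
    ext (i | j)
    · simpa using congrFun hxz i
    · simpa using congrFun hyz j

end LatticeFreeSum

section PolarFreeSum

lemma sumElim_mem_of_mem_convexHull {ι κ : Type*} [Fintype κ] {w : κ → ℝ} {A : Set (ι → ℝ)}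
    {B : Set (κ → ℝ)} {T : Set (ι ⊕ κ → ℝ)} (hT : Convex ℝ T)
    (h : ∀ a ∈ A, ∀ b ∈ B, Sum.elim ((1 - w ⬝ᵥ b) • a) b ∈ T) {a : ι → ℝ} {b : κ → ℝ}
    (ha : a ∈ convexHull ℝ A) (hb : b ∈ convexHull ℝ B) :
    Sum.elim ((1 - w ⬝ᵥ b) • a) b ∈ T := by
  have convex_right (a : ι → ℝ) : Convex ℝ {b | Sum.elim ((1 - w ⬝ᵥ b) • a) b ∈ T} := by
    intro b hb b' hb' s t hs ht hst
    rw [Set.mem_ofPred_eq]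
    convert hT hb hb' hs ht hst using 1
    ext (i | j)
    · simp only [dotProduct_add, dotProduct_smul, Sum.elim_inl, Pi.add_apply, Pi.smul_apply,
        smul_eq_mul]
      linear_combination -a i * hst
    · rfl
  have convex_left (b : κ → ℝ) : Convex ℝ {a | Sum.elim ((1 - w ⬝ᵥ b) • a) b ∈ T} := by
    intro a ha a' ha' s t hs ht hst
    rw [Set.mem_ofPred_eq]
    convert hT ha ha' hs ht hst using 1
    ext (i | j)
    · simp only [Sum.elim_inl, Pi.add_apply, Pi.smul_apply, smul_eq_mul]
      ring
    · exact (Convex.combo_self hst (b j)).symm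
  exact (convex_left b).convexHull_subset_iff.2
    (fun a ha => (convex_right a).convexHull_subset_iff.2 (h a ha) hb) ha

variable {ι κ : Type*} [Fintype ι] [Fintype κ] {P : Set (ι → ℝ)} {Q : Set (κ → ℝ)}

lemma sumElim_mem_polarDual_translate_freeSum_iff {w : κ → ℝ} {a : ι → ℝ} {b : κ → ℝ} :
    Sum.elim a b ∈ polarDual (translate (freeSum P (translate Q w)) (Sum.elim 0 (-w))) ↔
      (∀ x ∈ P, x ⬝ᵥ a ≤ 1 - w ⬝ᵥ b) ∧ b ∈ polarDual Q := by
  have hconv : Convex ℝ {z : ι ⊕ κ → ℝ | (z - Sum.elim (0 : ι → ℝ) (-w)) ⬝ᵥ Sum.elim a b ≤ 1} := by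
    simp only [sub_dotProduct, sub_le_iff_le_add]
    exact convex_halfSpace_le ⟨fun x y => add_dotProduct x y _, fun c x => smul_dotProduct c x _⟩ _
  have mem_iff : Sum.elim a b ∈
        polarDual (translate (freeSum P (translate Q w)) (Sum.elim 0 (-w))) ↔
      freeSum P (translate Q w) ⊆ {z | (z - Sum.elim (0 : ι → ℝ) (-w)) ⬝ᵥ Sum.elim a b ≤ 1} :=
    Set.forall_mem_image
  rw [mem_iff, freeSum, hconv.convexHull_subset_iff, Set.union_subset_iff, Set.image_subset_iff,
    Set.image_subset_iff, translate, Set.image_subset_iff]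
  refine and_congr (forall₂_congr fun x _ => ?_) (forall₂_congr fun y _ => ?_)
  · simp [le_sub_iff_add_le, sub_dotProduct]
  · simp [sub_dotProduct]

lemma polarDual_translate_freeSum (h0 : 0 ∈ interior P) {A : Set (ι → ℝ)} {B : Set (κ → ℝ)}
    (hA : polarDual P = convexHull ℝ A) (hB : polarDual Q = convexHull ℝ B) {w : κ → ℝ}
    (hw : w ∈ Q) :
    polarDual (translate (freeSum P (translate Q w)) (Sum.elim 0 (-w))) =
      convexHull ℝ (Set.image2 (fun a b => Sum.elim ((1 - w ⬝ᵥ b) • a) b) A B) := by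
  have nonneg {b : κ → ℝ} (hb : b ∈ polarDual Q) : 0 ≤ 1 - w ⬝ᵥ b := sub_nonneg.2 (hb w hw)
  refine subset_antisymm (fun z hz => ?_) ((convex_polarDual _).convexHull_subset_iff.2 ?_)
  · rw [← Sum.elim_comp_inl_inr z, sumElim_mem_polarDual_translate_freeSum_iff] at hz
    obtain ⟨a, ha, haz⟩ := mem_smul_polarDual_of_forall_le h0 (nonneg hz.2) hz.1
    rw [← Sum.elim_comp_inl_inr z, ← haz]
    refine sumElim_mem_of_mem_convexHull (convex_convexHull ℝ _)
      (fun a ha b hb => subset_convexHull ℝ _ ?_) (hA ▸ ha) (hB ▸ hz.2)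
    exact ⟨a, ha, b, hb, rfl⟩
  · rintro - ⟨a, ha, b, hb, rfl⟩
    have ha' : a ∈ polarDual P := hA ▸ subset_convexHull ℝ A ha
    have hb' : b ∈ polarDual Q := hB ▸ subset_convexHull ℝ B hb
    refine sumElim_mem_polarDual_translate_freeSum_iff.2 ⟨fun x hx => ?_, hb'⟩
    rw [dotProduct_smul, smul_eq_mul]
    exact mul_le_of_le_one_right (nonneg hb') (ha' x hx)

lemma IsCenteredReflexive.translate_freeSum (hP : IsCenteredReflexive P)
    (hQ : IsCenteredReflexive Q) {w : κ → ℤ} (hw : toReal w ∈ Q) :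
    IsCenteredReflexive
      (translate (freeSum P (translate Q (toReal w))) (toReal (Sum.elim 0 (-w)))) := by
  obtain ⟨A, hA, hA', hPA⟩ := hP.isLatticePolytope_polarDual
  obtain ⟨B, hB, hB', hQB⟩ := hQ.isLatticePolytope_polarDual
  refine ⟨(hP.isLatticePolytope.freeSum (hQ.isLatticePolytope.translate w)).translate _, ?_,
    Set.image2 (fun a b => Sum.elim ((1 - w ⬝ᵥ b) • a) b) A B, hA.image2 _ hB, hA'.image2 hB', ?_⟩
  · rw [interior_translate, mem_translate_iff, zero_add, toReal_sumElim, toReal_zero]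
    refine sumElim_zero_mem_interior_freeSum hP.zero_mem_interior ?_
    rw [interior_translate, mem_translate_iff, ← toReal_add, neg_add_cancel, toReal_zero]
    exact hQ.zero_mem_interior
  · rw [toReal_sumElim, toReal_zero, toReal_neg,
      polarDual_translate_freeSum hP.zero_mem_interior hPA hQB hw, Set.image2_image_left,
      Set.image2_image_right, Set.image_image2]
    simp only [toReal_sumElim, toReal_smul, toReal_dotProduct, Int.cast_sub, Int.cast_one]

end PolarFreeSum

section EhrhartSeries

lemma coeff_zero_one_sub_X_mul {R : Type*} [Ring R] (F : PowerSeries R) :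
    PowerSeries.coeff 0 ((1 - PowerSeries.X) * F) = PowerSeries.coeff 0 F := by
  rw [sub_mul, one_mul, map_sub, PowerSeries.coeff_zero_X_mul, sub_zero]

lemma coeff_succ_one_sub_X_mul {R : Type*} [Ring R] (n : ℕ) (F : PowerSeries R) :
    PowerSeries.coeff (n + 1) ((1 - PowerSeries.X) * F) =
      PowerSeries.coeff (n + 1) F - PowerSeries.coeff n F := by
  rw [sub_mul, one_mul, map_sub, PowerSeries.coeff_succ_X_mul]

variable {ι : Type*} {P : Set (ι → ℝ)}

lemma coeff_ehrhartSeries (hP : P.Nonempty) (m : ℕ) :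
    PowerSeries.coeff m (ehrhartSeries P) = {x : ι → ℤ | toReal x ∈ (m : ℝ) • P}.ncard := by
  rw [ehrhartSeries, PowerSeries.coeff_mk]
  split_ifs with hm
  · have hzero : {x : ι → ℤ | toReal x ∈ (m : ℝ) • P} = {0} := by
      ext x
      rw [hm, Nat.cast_zero, Set.zero_smul_set hP, Set.mem_ofPred_eq, Set.mem_zero, ← toReal_zero,
        toReal_injective.eq_iff, Set.mem_singleton_iff]
    rw [hzero, Set.ncard_singleton, Nat.cast_one]
  · rfl

lemma hStar_zero (P : Set (ι → ℝ)) : hStar P 0 = 1 := by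
  simp [hStar, ehrhartSeries]

lemma dim_eq_card_of_interior_nonempty [Fintype ι] (hP : (interior P).Nonempty) :
    dim P = Fintype.card ι := by
  have hspan : affineSpan ℝ P = ⊤ :=
    affineSpan_eq_top_of_nonempty_interior (hP.mono (interior_mono (subset_convexHull ℝ P)))
  rw [dim, AffineSubspace.vectorSpan_eq_top_of_affineSpan_eq_top ℝ _ _ hspan, finrank_top,
    Module.finrank_pi]

end EhrhartSeries

section Shell

variable {ι : Type*} [Fintype ι] {P : Set (ι → ℝ)}

/-- The lattice points on the boundary of `n P`, for `P` a reflexive polytope with centre the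
origin: these are the lattice points in `n P` that are not in `(n - 1) P`. -/
def shell {ι : Type*} (P : Set (ι → ℝ)) (n : ℕ) : Set (ι → ℤ) :=
  {x | gauge P (toReal x) = n}

namespace IsCenteredReflexive

lemma coeff_ehrhartSeries_eq (hP : IsCenteredReflexive P) (m : ℕ) :
    PowerSeries.coeff m (ehrhartSeries P) = {x : ι → ℤ | gauge P (toReal x) ≤ m}.ncard := by
  simp only [coeff_ehrhartSeries ⟨0, hP.zero_mem⟩, hP.gauge_le_iff m.cast_nonneg]

lemma finite_setOf_gauge_le (hP : IsCenteredReflexive P) (m : ℕ) :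
    {x : ι → ℤ | gauge P (toReal x) ≤ m}.Finite := by
  simp only [hP.gauge_le_iff m.cast_nonneg]
  exact finite_toReal_preimage (hP.isLatticePolytope.isCompact.smul _)

lemma finite_shell (hP : IsCenteredReflexive P) (m : ℕ) : (shell P m).Finite :=
  (hP.finite_setOf_gauge_le m).subset fun _ hx => (Set.mem_ofPred_eq ▸ hx).le

lemma coeff_one_sub_X_mul_ehrhartSeries (hP : IsCenteredReflexive P) (m : ℕ) :
    PowerSeries.coeff m ((1 - PowerSeries.X) * ehrhartSeries P) =
      ((shell P m).ncard : ℤ) := by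
  cases m with
  | zero =>
    rw [coeff_zero_one_sub_X_mul, hP.coeff_ehrhartSeries_eq, shell, Nat.cast_zero]
    simp only [(gauge_nonneg _).ge_iff_eq']
  | succ m =>
    have shell_eq : shell P (m + 1) = {x : ι → ℤ | gauge P (toReal x) ≤ (m + 1 : ℕ)} \
        {x | gauge P (toReal x) ≤ m} := by
      ext x
      obtain ⟨n, hn⟩ := hP.exists_gauge_eq_natCast x
      simp only [shell, Set.mem_sdiff, Set.mem_ofPred_eq, hn, Nat.cast_inj, Nat.cast_le]
      lia
    have subset : {x : ι → ℤ | gauge P (toReal x) ≤ m} ⊆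
        {x : ι → ℤ | gauge P (toReal x) ≤ (m + 1 : ℕ)} :=
      fun x hx => hx.out.trans (Nat.cast_le.2 m.le_succ)
    rw [coeff_succ_one_sub_X_mul, hP.coeff_ehrhartSeries_eq, hP.coeff_ehrhartSeries_eq,
      shell_eq, ← Set.ncard_sdiff_add_ncard_of_subset subset (hP.finite_setOf_gauge_le _),
      Nat.cast_add, add_sub_cancel_right]

variable {κ : Type*} {Q : Set (κ → ℝ)}

lemma preimage_setOf_mem_smul_freeSum (hP : IsCenteredReflexive P) (hQ : Convex ℝ Q) (h0 : 0 ∈ Q)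
    (m : ℕ) :
    (Equiv.sumArrowEquivProdArrow ι κ ℤ).symm ⁻¹' {z | toReal z ∈ (m : ℝ) • freeSum P Q} =
      ⋃ p ∈ (antidiagonal m : Set (ℕ × ℕ)),
        shell P p.1 ×ˢ {y | toReal y ∈ (p.2 : ℝ) • Q} := by
  ext ⟨x, y⟩
  obtain ⟨n, hn⟩ := hP.exists_gauge_eq_natCast x
  have toReal_symm : toReal ((Equiv.sumArrowEquivProdArrow ι κ ℤ).symm (x, y)) =
      Sum.elim (toReal x) (toReal y) := toReal_sumElim x y
  rw [Set.mem_preimage, Set.mem_ofPred_eq, toReal_symm, hP.sumElim_mem_smul_freeSum_iff hQ h0 hn]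
  simp only [shell, Set.mem_iUnion, Finset.mem_coe, mem_antidiagonal, Set.mem_prod,
    Set.mem_ofPred_eq, hn, Nat.cast_inj, Prod.exists, exists_prop]
  aesop

theorem ehrhartSeries_freeSum [Finite κ] (hP : IsCenteredReflexive P) (hQ : Convex ℝ Q)
    (hQc : IsCompact Q) (h0 : 0 ∈ Q) :
    ehrhartSeries (freeSum P Q) = (1 - PowerSeries.X) * ehrhartSeries P * ehrhartSeries Q := by
  ext m
  have finite (p : ℕ × ℕ) : (shell P p.1 ×ˢ {y | toReal y ∈ (p.2 : ℝ) • Q}).Finite :=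
    (hP.finite_shell _).prod (finite_toReal_preimage (hQc.smul _))
  have disjoint : (antidiagonal m : Set (ℕ × ℕ)).PairwiseDisjoint
      fun p => shell P p.1 ×ˢ {y | toReal y ∈ (p.2 : ℝ) • Q} := by
    intro p hp q hq hpq
    refine Set.disjoint_left.2 fun z hzp hzq => hpq ?_
    have fst_eq : p.1 = q.1 := Nat.cast_injective (hzp.1.out.symm.trans hzq.1.out)
    have sum_eq := (mem_antidiagonal.1 hp).trans (mem_antidiagonal.1 hq).symm
    exact Prod.ext fst_eq (Nat.add_left_cancel (fst_eq ▸ sum_eq))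
  rw [coeff_ehrhartSeries ⟨_, sumElim_zero_left_mem_freeSum h0⟩,
    ← Set.ncard_preimage_of_injective_subset_range
      (Equiv.sumArrowEquivProdArrow ι κ ℤ).symm.injective (fun z _ => Equiv.surjective _ z),
    hP.preimage_setOf_mem_smul_freeSum hQ h0,
    (Finset.finite_toSet _).ncard_biUnion (fun p _ => finite p) disjoint, finsum_mem_coe_finset,
    PowerSeries.coeff_mul, Nat.cast_sum]
  refine Finset.sum_congr rfl fun p _ => ?_
  rw [Set.ncard_prod, Nat.cast_mul, hP.coeff_one_sub_X_mul_ehrhartSeries,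
    coeff_ehrhartSeries ⟨0, h0⟩]

theorem hStar_freeSum [Finite κ] (hP : IsCenteredReflexive P) (hQ : Convex ℝ Q)
    (hQc : IsCompact Q) (h0 : 0 ∈ Q) (hQ' : (interior Q).Nonempty) (m : ℕ) :
    hStar (freeSum P Q) m = ∑ p ∈ antidiagonal m, hStar P p.1 * hStar Q p.2 := by
  have := Fintype.ofFinite κ
  obtain ⟨w, hw⟩ := hQ'
  rw [hStar, hP.ehrhartSeries_freeSum hQ hQc h0,
    dim_eq_card_of_interior_nonempty ⟨_, sumElim_zero_mem_interior_freeSum hP.zero_mem_interior hw⟩,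
    Fintype.card_sum]
  simp only [hStar]
  rw [← PowerSeries.coeff_mul, dim_eq_card_of_interior_nonempty ⟨0, hP.zero_mem_interior⟩,
    dim_eq_card_of_interior_nonempty ⟨w, hw⟩]
  congr 1
  ring

end IsCenteredReflexive

end Shell

lemma convexHull_insert_of_mem {E : Type*} [AddCommGroup E] [Module ℝ E] {s : Set E} {x : E}
    (hx : x ∈ convexHull ℝ s) : convexHull ℝ (insert x s) = convexHull ℝ s :=
  ((convex_convexHull ℝ s).convexHull_subset_iff.2
    (Set.insert_subset hx (subset_convexHull ℝ s))).antisymm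
    (convexHull_mono (Set.subset_insert x s))

section SimplexFreeSum

variable {ι κ σ τ : Type*}

lemma isSimplex_convexHull_range [Finite σ] [Nonempty σ] {v : σ → ι → ℝ}
    (hv : AffineIndependent ℝ v) : IsSimplex (convexHull ℝ (Set.range v)) := by
  obtain ⟨k, hk⟩ := Nat.exists_eq_succ_of_ne_zero (Nat.card_pos (α := σ)).ne'
  let e : Fin (k + 1) ≃ σ := (Finite.equivFinOfCardEq hk).symm
  refine ⟨k, v ∘ e, hv.comp_embedding e.toEmbedding, ?_⟩
  rw [e.surjective.range_comp]

lemma affineIndependent_sumElim [Finite σ] [Finite τ] {a : σ → ι → ℝ} {c : τ → κ → ℝ}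
    (ha : AffineIndependent ℝ a) (hc : LinearIndependent ℝ c) :
    AffineIndependent ℝ (Sum.elim (fun k => Sum.elim (a k) 0) fun l => Sum.elim 0 (c l) :
      σ ⊕ τ → ι ⊕ κ → ℝ) := by
  have := Fintype.ofFinite σ
  have := Fintype.ofFinite τ
  rw [affineIndependent_iff_of_fintype] at ha ⊢
  rw [Fintype.linearIndependent_iff] at hc
  intro w hw hsum
  rw [Finset.weightedVSub_eq_linear_combination _ hw, Fintype.sum_sum_type] at hsum
  have hr : ∀ l, w (Sum.inr l) = 0 := by
    refine hc _ ?_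
    ext j
    simpa using congrFun hsum (Sum.inr j)
  simp only [Fintype.sum_sum_type, hr, Finset.sum_const_zero, add_zero, zero_smul] at hw hsum
  have hl : ∀ k, w (Sum.inl k) = 0 := by
    refine ha _ hw ?_
    rw [Finset.weightedVSub_eq_linear_combination _ hw]
    ext j
    simpa using congrFun hsum (Sum.inl j)
  exact Sum.rec hl hr

-- The vertex `0` of `Q` is dropped, because it already lies in the copy of `P`.
lemma IsSimplex.freeSum {P : Set (ι → ℝ)} {Q : Set (κ → ℝ)} (hP : IsSimplex P)
    (h0 : 0 ∈ P) (hQ : IsSimplex Q) (h0' : 0 ∈ Q.extremePoints ℝ) : IsSimplex (freeSum P Q) := by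
  obtain ⟨k, a, ha, rfl⟩ := hP
  obtain ⟨l, c, hc, rfl⟩ := hQ
  obtain ⟨i, hi⟩ := extremePoints_convexHull_subset h0'
  have hc' : LinearIndependent ℝ fun j : {j // j ≠ i} => c j := by
    simpa only [hi, vsub_eq_sub, sub_zero] using
      (affineIndependent_iff_linearIndependent_vsub ℝ c i).1 hc
  have hrange : Set.range c = insert 0 (Set.range fun j : {j // j ≠ i} => c j) := by
    refine subset_antisymm ?_
      (Set.insert_subset ⟨i, hi⟩ (Set.range_subset_iff.2 fun j => ⟨j, rfl⟩))
    rintro - ⟨j, rfl⟩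
    obtain rfl | hj := eq_or_ne j i
    exacts [Or.inl hi, Or.inr ⟨⟨j, hj⟩, rfl⟩]
  have hzero : (Sum.elim 0 0 : ι ⊕ κ → ℝ) ∈
      convexHull ℝ ((Sum.elim · (0 : κ → ℝ)) '' Set.range a) := by
    rw [← isLinearMap_sumElim_zero_right.image_convexHull]
    exact Set.mem_image_of_mem _ h0
  convert isSimplex_convexHull_range (affineIndependent_sumElim ha hc') using 1
  rw [freeSum_convexHull, Set.Sum.elim_range, hrange, Set.image_insert_eq, Set.union_insert,
    convexHull_insert_of_mem (convexHull_mono Set.subset_union_left hzero), ← Set.range_comp,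
    ← Set.range_comp]
  rfl

end SimplexFreeSum

section HomogeneousCoordinates

variable {σ E : Type*} [AddCommGroup E] [Module ℝ E] (b : AffineBasis σ ℝ E)

/-- The barycentric coordinates, homogenized: the linear function on `E × ℝ` which restricts to
the coordinate `b.coord i` at height one. The cone over the simplex spanned by `b` is where these
functions are nonnegative. -/
noncomputable def homCoord (i : σ) : E × ℝ →ₗ[ℝ] ℝ :=
  (b.coord i).linear ∘ₗ LinearMap.fst ℝ E ℝ + b.coord i 0 • LinearMap.snd ℝ E ℝ

lemma homCoord_one (i : σ) (x : E) : homCoord b i (x, 1) = b.coord i x :=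
  calc
    homCoord b i (x, 1) = (b.coord i).linear x + b.coord i 0 := by simp [homCoord]
    _ = b.coord i x := ((b.coord i).map_vadd 0 x).symm.trans (by rw [vadd_eq_add, add_zero])

lemma homCoord_eq_mul_coord (i : σ) {r : ℝ} (hr : r ≠ 0) (x : E) :
    homCoord b i (x, r) = r * b.coord i (r⁻¹ • x) := by
  rw [← homCoord_one, ← smul_eq_mul, ← map_smul, Prod.smul_mk, smul_inv_smul₀ hr, smul_eq_mul,
    mul_one]

lemma linearMap_ext_of_height_one {F : Type*} [AddCommGroup F] [Module ℝ F]
    {f g : E × ℝ →ₗ[ℝ] F} (h : ∀ x, f (x, 1) = g (x, 1)) : f = g := by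
  refine LinearMap.ext fun z => ?_
  have hz : z = (z.1, 1) + (z.2 - 1) • ((0, 1) - (0, 0)) := by ext <;> simp
  have hzero : f (0, 0) = g (0, 0) := by simp only [Prod.mk_zero_zero, map_zero]
  rw [hz]
  simp only [map_add, map_smul, map_sub, h, hzero]

lemma sum_homCoord [Fintype σ] (z : E × ℝ) : ∑ i, homCoord b i z = z.2 := by
  have : ∑ i, homCoord b i = LinearMap.snd ℝ E ℝ := by
    refine linearMap_ext_of_height_one fun x => ?_
    rw [LinearMap.sum_apply]
    simp only [homCoord_one]
    exact b.sum_coord_apply_eq_one x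
  rw [← LinearMap.sum_apply, this, LinearMap.snd_apply]

lemma sum_homCoord_smul [Fintype σ] (z : E × ℝ) : ∑ i, homCoord b i z • b i = z.1 := by
  have : ∑ i, (homCoord b i).smulRight (b i) = LinearMap.fst ℝ E ℝ := by
    refine linearMap_ext_of_height_one fun x => ?_
    rw [LinearMap.sum_apply]
    simp only [LinearMap.smulRight_apply, homCoord_one]
    exact b.linear_combination_coord_eq_self x
  simpa only [LinearMap.sum_apply, LinearMap.smulRight_apply, LinearMap.fst_apply] using
    LinearMap.congr_fun this z

variable [Finite σ]

lemma eq_zero_of_homCoord_nonneg {x : E} (h : ∀ i, 0 ≤ homCoord b i (x, 0)) : x = 0 := by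
  have := Fintype.ofFinite σ
  have h0 := (Finset.sum_eq_zero_iff_of_nonneg fun i _ => h i).1 (sum_homCoord b (x, 0))
  calc
    x = ∑ i, homCoord b i (x, 0) • b i := (sum_homCoord_smul b (x, 0)).symm
    _ = 0 := Finset.sum_eq_zero fun i hi => by rw [h0 i hi, zero_smul]

lemma mem_smul_convexHull_iff {r : ℝ} (hr : 0 ≤ r) {x : E} :
    x ∈ r • convexHull ℝ (Set.range b) ↔ ∀ i, 0 ≤ homCoord b i (x, r) := by
  have := Fintype.ofFinite σ
  obtain rfl | hr := hr.eq_or_lt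
  · have := b.nonempty
    rw [Set.zero_smul_set (Set.range_nonempty b).convexHull, Set.mem_zero]
    refine ⟨fun h i => ?_, eq_zero_of_homCoord_nonneg b⟩
    rw [h, Prod.mk_zero_zero, map_zero]
  · simp only [Set.mem_smul_set_iff_inv_smul_mem₀ hr.ne', b.convexHull_eq_nonneg_coord,
      Set.mem_ofPred_eq, homCoord_eq_mul_coord b _ hr.ne', mul_nonneg_iff_of_pos_left hr]

lemma mem_extremePoints_convexHull_range (i : σ) :
    b i ∈ (convexHull ℝ (Set.range b)).extremePoints ℝ := by
  classical
  have := Fintype.ofFinite σ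
  refine ⟨subset_convexHull ℝ _ ⟨i, rfl⟩, ?_⟩
  rw [b.convexHull_eq_nonneg_coord]
  rintro x hx y hy ⟨r, s, hr, hs, hrs, hxy⟩
  have hzero (j : σ) (hj : j ≠ i) : b.coord j x = 0 := by
    have hsum := Convex.combo_affine_apply (f := b.coord j) (x := x) (y := y) hrs
    rw [hxy, b.coord_apply_ne hj] at hsum
    have := (add_eq_zero_iff_of_nonneg (smul_nonneg hr.le (hx j)) (smul_nonneg hs.le (hy j))).1
      hsum.symm
    exact (smul_eq_zero_iff_right hr.ne').1 this.1
  have hone : b.coord i x = 1 := by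
    rw [← b.sum_coord_apply_eq_one x, Fintype.sum_eq_single i hzero]
  refine b.ext_elem fun j => ?_
  obtain rfl | hj := eq_or_ne j i
  · rw [hone, b.coord_apply_eq]
  · rw [hzero j hj, b.coord_apply_ne hj]

end HomogeneousCoordinates

lemma mem_interior_smul_convexHull_iff {σ E : Type*} [Finite σ] [NormedAddCommGroup E]
    [NormedSpace ℝ E] (b : AffineBasis σ ℝ E) {r : ℝ} (hr : 0 < r) {x : E} :
    x ∈ interior (r • convexHull ℝ (Set.range b)) ↔ ∀ i, 0 < homCoord b i (x, r) := by
  simp only [interior_smul₀ hr.ne', Set.mem_smul_set_iff_inv_smul_mem₀ hr.ne',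
    b.interior_convexHull, Set.mem_ofPred_eq, homCoord_eq_mul_coord b _ hr.ne',
    mul_pos_iff_of_pos_left hr]

section HalfOpenBox

variable {ι σ : Type*} {b : AffineBasis σ ℝ (ι → ℝ)}

lemma IsSimplex.exists_affineBasis [Finite ι] {P : Set (ι → ℝ)} (hP : IsSimplex P)
    (hP' : IsLatticePolytope P) (hi : (interior P).Nonempty) :
    ∃ (k : ℕ) (b : AffineBasis (Fin (k + 1)) ℝ (ι → ℝ)) (p : Fin (k + 1) → ι → ℤ),
      P = convexHull ℝ (Set.range b) ∧ ∀ i, b i = toReal (p i) := by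
  have := Fintype.ofFinite ι
  obtain ⟨k, v, hv, rfl⟩ := hP
  rw [interior_convexHull_nonempty_iff_affineSpan_eq_top] at hi
  let b : AffineBasis (Fin (k + 1)) ℝ (ι → ℝ) := ⟨v, hv, hi⟩
  choose p hp using fun i =>
    hP'.exists_eq_toReal_of_mem_extremePoints (mem_extremePoints_convexHull_range b i)
  exact ⟨k, b, p, rfl, fun i => (hp i).symm⟩

/-- The lattice points of height `m` in the cone over the simplex spanned by `b` whose coordinates
with index in `I` are less than one. Taking for `I` all indices gives the height `m` part of the
half-open fundamental parallelepiped, which is counted by the entry `h*_m` of the simplex. -/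
def partialBox (b : AffineBasis σ ℝ (ι → ℝ)) (I : Finset σ) (m : ℕ) : Set (ι → ℤ) :=
  {x | (∀ i, 0 ≤ homCoord b i (toReal x, (m : ℝ))) ∧
    ∀ i ∈ I, homCoord b i (toReal x, (m : ℝ)) < 1}

lemma homCoord_add_vertex [DecidableEq σ] {p : σ → ι → ℤ} (hp : ∀ i, b i = toReal (p i))
    (i j : σ) (x : ι → ℤ) (m : ℕ) :
    homCoord b i (toReal (x + p j), ((m + 1 : ℕ) : ℝ)) =
      homCoord b i (toReal x, (m : ℝ)) + if i = j then 1 else 0 := by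
  rw [toReal_add, ← hp, Nat.cast_succ, ← Prod.mk_add_mk, map_add, homCoord_one, b.coord_apply]

lemma preimage_partialBox_sdiff [DecidableEq σ] {p : σ → ι → ℤ} (hp : ∀ i, b i = toReal (p i))
    {I : Finset σ} {i : σ} (hi : i ∉ I) (m : ℕ) :
    (· + p i) ⁻¹' (partialBox b I (m + 1) \ partialBox b (insert i I) (m + 1)) =
      partialBox b I m := by
  ext x
  have hne (j : σ) (hj : j ≠ i) : homCoord b j (toReal (x + p i), ((m + 1 : ℕ) : ℝ)) =
      homCoord b j (toReal x, (m : ℝ)) := by rw [homCoord_add_vertex hp, if_neg hj, add_zero]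
  have hself : homCoord b i (toReal (x + p i), ((m + 1 : ℕ) : ℝ)) =
      homCoord b i (toReal x, (m : ℝ)) + 1 := by rw [homCoord_add_vertex hp, if_pos rfl]
  have hmem (j : σ) (hj : j ∈ I) : j ≠ i := ne_of_mem_of_not_mem hj hi
  simp only [partialBox, Set.mem_preimage, Set.mem_sdiff, Set.mem_ofPred_eq,
    Finset.forall_mem_insert, hself]
  constructor
  · rintro ⟨⟨hnonneg, hlt⟩, hnot⟩
    have hge : 0 ≤ homCoord b i (toReal x, (m : ℝ)) := by
      by_contra! h
      exact hnot ⟨hnonneg, by linarith, hlt⟩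
    refine ⟨fun j => ?_, fun j hj => hne j (hmem j hj) ▸ hlt j hj⟩
    obtain rfl | hj := eq_or_ne j i
    exacts [hge, hne j hj ▸ hnonneg j]
  · rintro ⟨hnonneg, hlt⟩
    refine ⟨⟨fun j => ?_, fun j hj => (hne j (hmem j hj)).symm ▸ hlt j hj⟩,
      fun h => by linarith [h.2.1, hnonneg i]⟩
    obtain rfl | hj := eq_or_ne j i
    · linarith [hnonneg j]
    · exact (hne j hj).symm ▸ hnonneg j

variable [Finite σ]

lemma finite_partialBox [Finite ι] (I : Finset σ) (m : ℕ) : (partialBox b I m).Finite := by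
  have hcompact := ((Set.finite_range b).isCompact_convexHull ℝ).smul (m : ℝ)
  exact (finite_toReal_preimage hcompact).subset fun x hx =>
    (mem_smul_convexHull_iff b m.cast_nonneg).2 hx.1

lemma partialBox_zero (I : Finset σ) : partialBox b I 0 = {0} := by
  ext x
  simp only [partialBox, Set.mem_ofPred_eq, Nat.cast_zero, Set.mem_singleton_iff]
  constructor
  · rintro ⟨hx, -⟩
    exact toReal_injective ((eq_zero_of_homCoord_nonneg b hx).trans toReal_zero.symm)
  · rintro rfl
    simp only [toReal_zero, Prod.mk_zero_zero, map_zero, le_refl, zero_lt_one, implies_true,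
      and_self]

lemma ncard_partialBox_succ [Finite ι] [DecidableEq σ] {p : σ → ι → ℤ}
    (hp : ∀ i, b i = toReal (p i)) {I : Finset σ} {i : σ} (hi : i ∉ I) (m : ℕ) :
    (partialBox b I m).ncard + (partialBox b (insert i I) (m + 1)).ncard =
      (partialBox b I (m + 1)).ncard := by
  have hsub : partialBox b (insert i I) (m + 1) ⊆ partialBox b I (m + 1) :=
    fun x hx => ⟨hx.1, fun j hj => hx.2 j (Finset.mem_insert_of_mem hj)⟩
  rw [← Set.ncard_sdiff_add_ncard_of_subset hsub (finite_partialBox I (m + 1)),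
    ← preimage_partialBox_sdiff hp hi, Set.ncard_preimage_of_injective_subset_range
      (add_left_injective _) fun x _ => ⟨x - p i, sub_add_cancel x (p i)⟩]

lemma one_sub_X_pow_mul_ehrhartSeries [Finite ι] {p : σ → ι → ℤ}
    (hp : ∀ i, b i = toReal (p i)) (I : Finset σ) :
    (1 - PowerSeries.X) ^ I.card * ehrhartSeries (convexHull ℝ (Set.range b)) =
      PowerSeries.mk fun m => ((partialBox b I m).ncard : ℤ) := by
  classical
  have := b.nonempty
  induction I using Finset.induction_on with
  | empty =>
    ext m
    rw [Finset.card_empty, pow_zero, one_mul,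
      coeff_ehrhartSeries (Set.range_nonempty b).convexHull, PowerSeries.coeff_mk]
    simp only [mem_smul_convexHull_iff b m.cast_nonneg, partialBox, Finset.notMem_empty,
      IsEmpty.forall_iff, implies_true, and_true]
  | insert i I hi ih =>
    rw [Finset.card_insert_of_notMem hi, pow_succ', mul_assoc, ih]
    ext m
    cases m with
    | zero => simp only [coeff_zero_one_sub_X_mul, PowerSeries.coeff_mk, partialBox_zero]
    | succ m =>
      simp only [coeff_succ_one_sub_X_mul, PowerSeries.coeff_mk]
      rw [← ncard_partialBox_succ hp hi, Nat.cast_add, add_sub_cancel_left]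

end HalfOpenBox

section HStarOfSimplex

variable {ι σ : Type*} [Fintype ι] [Fintype σ] {b : AffineBasis σ ℝ (ι → ℝ)} {p : σ → ι → ℤ}

lemma card_eq_card_add_one (b : AffineBasis σ ℝ (ι → ℝ)) :
    Fintype.card σ = Fintype.card ι + 1 := by
  rw [b.card_eq_finrank_add_one, Module.finrank_pi]

theorem hStar_convexHull_range {ι : Type*} [Finite ι] {b : AffineBasis σ ℝ (ι → ℝ)}
    {p : σ → ι → ℤ} (hp : ∀ i, b i = toReal (p i)) (m : ℕ) :
    hStar (convexHull ℝ (Set.range b)) m = (partialBox b Finset.univ m).ncard := by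
  have := Fintype.ofFinite ι
  have hdim : dim (convexHull ℝ (Set.range b)) = Fintype.card ι :=
    dim_eq_card_of_interior_nonempty
      (interior_convexHull_nonempty_iff_affineSpan_eq_top.2 b.tot)
  rw [hStar, hdim, ← card_eq_card_add_one b, ← Finset.card_univ,
    one_sub_X_pow_mul_ehrhartSeries hp, PowerSeries.coeff_mk]

lemma partialBox_univ_eq_empty (b : AffineBasis σ ℝ (ι → ℝ)) {m : ℕ} (hm : Fintype.card ι < m) :
    partialBox b Finset.univ m = ∅ := by
  refine Set.eq_empty_iff_forall_notMem.2 fun x hx => ?_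
  have := b.nonempty
  have hlt : ∑ i, homCoord b i (toReal x, (m : ℝ)) < ∑ _i : σ, (1 : ℝ) :=
    Finset.sum_lt_sum_of_nonempty Finset.univ_nonempty hx.2
  rw [sum_homCoord, Finset.sum_const, Finset.card_univ, nsmul_one, card_eq_card_add_one b,
    Nat.cast_lt] at hlt
  lia

lemma sum_vertices_sub_mem_partialBox (hp : ∀ i, b i = toReal (p i))
    (hb : IsCenteredReflexive (convexHull ℝ (Set.range b))) {j k : ℕ}
    (hjk : j + k = Fintype.card ι) {x : ι → ℤ} (hx : x ∈ partialBox b Finset.univ j) :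
    ∑ i, p i - x ∈ partialBox b Finset.univ k := by
  have hadd : (toReal (∑ i, p i - x), ((k + 1 : ℕ) : ℝ)) + (toReal x, (j : ℝ)) =
      ∑ i, (b i, (1 : ℝ)) := by
    refine Prod.ext ?_ ?_
    · rw [Prod.mk_add_mk, ← toReal_add, sub_add_cancel, Prod.fst_sum]
      ext l
      simp only [hp, toReal, Finset.sum_apply, Int.cast_sum]
    · rw [Prod.mk_add_mk, Prod.snd_sum, Finset.sum_const, Finset.card_univ,
        card_eq_card_add_one b, ← hjk, nsmul_one]
      push_cast
      ring
  have hsum (i : σ) : homCoord b i (∑ l, (b l, (1 : ℝ))) = 1 := by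
    classical
    simp only [map_sum, homCoord_one, b.coord_apply, Finset.sum_ite_eq, Finset.mem_univ, if_true]
  have hcoord (i : σ) : homCoord b i (toReal (∑ i, p i - x), ((k + 1 : ℕ) : ℝ)) =
      1 - homCoord b i (toReal x, (j : ℝ)) := by
    rw [eq_sub_iff_add_eq, ← map_add, hadd, hsum]
  have hinterior : toReal (∑ i, p i - x) ∈
      interior (((k + 1 : ℕ) : ℝ) • convexHull ℝ (Set.range b)) := by
    rw [mem_interior_smul_convexHull_iff b (Nat.cast_pos.2 k.succ_pos)]
    exact fun i => hcoord i ▸ sub_pos.2 (hx.2 i (Finset.mem_univ i))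
  refine ⟨(mem_smul_convexHull_iff b k.cast_nonneg).1
    (hb.mem_smul_of_mem_interior_smul hinterior), fun i _ => ?_⟩
  have hzero : 0 < homCoord b i ((0 : ι → ℝ), (1 : ℝ)) :=
    (mem_interior_smul_convexHull_iff b one_pos).1
      ((one_smul ℝ (convexHull ℝ (Set.range b))).symm ▸ hb.zero_mem_interior) i
  have hheight : homCoord b i (toReal (∑ i, p i - x), ((k + 1 : ℕ) : ℝ)) =
      homCoord b i (toReal (∑ i, p i - x), (k : ℝ)) + homCoord b i ((0 : ι → ℝ), (1 : ℝ)) := by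
    rw [← map_add, Prod.mk_add_mk, add_zero, Nat.cast_succ]
  linarith [hcoord i, hx.1 i]

variable {P : Set (ι → ℝ)}

theorem IsSimplex.hStar_eq_zero_of_card_lt (hP : IsSimplex P) (hP' : IsLatticePolytope P)
    (hi : (interior P).Nonempty) {m : ℕ} (hm : Fintype.card ι < m) : hStar P m = 0 := by
  obtain ⟨k, b, p, rfl, hp⟩ := hP.exists_affineBasis hP' hi
  rw [hStar_convexHull_range hp, partialBox_univ_eq_empty b hm, Set.ncard_empty, Nat.cast_zero]

theorem IsCenteredReflexive.hStar_symm (hP : IsCenteredReflexive P) (hP' : IsSimplex P) {j k : ℕ}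
    (hjk : j + k = Fintype.card ι) : hStar P j = hStar P k := by
  obtain ⟨n, b, p, rfl, hp⟩ :=
    hP'.exists_affineBasis hP.isLatticePolytope ⟨0, hP.zero_mem_interior⟩
  have hle {j k : ℕ} (hjk : j + k = Fintype.card ι) :
      (partialBox b Finset.univ j).ncard ≤ (partialBox b Finset.univ k).ncard :=
    Set.ncard_le_ncard_of_injOn (fun x => ∑ i, p i - x)
      (fun x hx => sum_vertices_sub_mem_partialBox hp hP hjk hx)
      sub_right_injective.injOn (finite_partialBox _ _)
  rw [hStar_convexHull_range hp, hStar_convexHull_range hp,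
    (hle hjk).antisymm (hle ((add_comm k j).trans hjk))]

end HStarOfSimplex

section SymmetricUnimodal

/-- The sequences `F` on `ℤ` supported in `0, …, n`, symmetric about `n / 2`, and nondecreasing up
to the middle. Indexing by `ℤ` rather than by `0, …, n` spares the boundary terms in convolutions;
comparing `F (-1) = 0` with `F 0` shows that such a sequence is nonnegative. -/
structure IsSymmUnimodal {R : Type*} [Zero R] [LE R] (F : ℤ → R) (n : ℤ) : Prop where
  eq_zero_of_neg : ∀ i < 0, F i = 0
  symm : ∀ i, F (n - i) = F i
  le_succ : ∀ i, 2 * i + 1 ≤ n → F i ≤ F (i + 1)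

namespace IsSymmUnimodal

section Zero

variable {R : Type*} [Zero R] {F : ℤ → R} {n : ℤ}

lemma finite_support [LE R] (hF : IsSymmUnimodal F n) : (Function.support F).Finite := by
  refine (Set.finite_Icc 0 n).subset fun i hi => ⟨?_, ?_⟩ <;> by_contra! h
  · exact hi (hF.eq_zero_of_neg i h)
  · exact hi ((hF.symm i).symm.trans (hF.eq_zero_of_neg _ (by lia)))

lemma le_of_le_of_add_le [Preorder R] (hF : IsSymmUnimodal F n) {i j : ℤ} (hij : i ≤ j)
    (hn : i + j ≤ n) : F i ≤ F j := by
  have monotone {j : ℤ} (hij : i ≤ j) : 2 * j ≤ n + 1 → F i ≤ F j := by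
    induction j, hij using Int.leInduction with
    | base => exact fun _ => le_rfl
    | succ j _ ih => exact fun hj => (ih (by lia)).trans (hF.le_succ j (by lia))
  obtain hj | hj := le_total (2 * j) n
  · exact monotone hij (by lia)
  · rw [← hF.symm j]
    exact monotone (by lia) (by lia)

end Zero

section Ring

variable {R : Type*} [Ring R] {F G : ℤ → R} {n m : ℤ}

lemma finite_support_mul [LE R] (hG : IsSymmUnimodal G m) (f : ℤ → R) :
    (Function.support fun k => f k * G k).Finite :=
  hG.finite_support.subset (Function.support_mul_subset_right f G)

lemma two_mul_convolution_succ_sub [LE R] (hG : IsSymmUnimodal G m) (F : ℤ → R) (j : ℤ) :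
    2 * (∑ᶠ k, F (j + 1 - k) * G k - ∑ᶠ k, F (j - k) * G k) =
      ∑ᶠ k, (F (j + 1 - k) - F (j - m + k)) * (G k - G (k - 1)) := by
  have finite_pred : (Function.support fun k => G (k - 1)).Finite :=
    hG.finite_support.preimage sub_left_injective.injOn
  have finite (f : ℤ → R) : (Function.support fun k => f k * (G k - G (k - 1))).Finite :=
    (hG.finite_support.union finite_pred).subset
      ((Function.support_mul_subset_right f _).trans (Function.support_sub G _))
  have shift : ∑ᶠ k, F (j - k) * G k = ∑ᶠ k, F (j + 1 - k) * G (k - 1) := by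
    rw [← finsum_comp_equiv (Equiv.subRight 1)]
    exact finsum_congr fun k => by rw [Equiv.subRight_apply, sub_sub_eq_add_sub]
  have finite_shift : (Function.support fun k => F (j + 1 - k) * G (k - 1)).Finite :=
    finite_pred.subset
      (Function.support_mul_subset_right _ fun k => G (k - 1))
  have difference : ∑ᶠ k, F (j + 1 - k) * G k - ∑ᶠ k, F (j - k) * G k =
      ∑ᶠ k, F (j + 1 - k) * (G k - G (k - 1)) := by
    rw [shift, ← finsum_sub_distrib (hG.finite_support_mul _) finite_shift]
    simp only [mul_sub]
  have reflect : ∑ᶠ k, F (j + 1 - k) * (G k - G (k - 1)) =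
      -∑ᶠ k, F (j - m + k) * (G k - G (k - 1)) := by
    rw [← finsum_comp_equiv (Equiv.subLeft (m + 1)), ← finsum_neg_distrib]
    refine finsum_congr fun k => ?_
    have h₁ : G (m + 1 - k) = G (k - 1) := by rw [← hG.symm (k - 1)]; congr 1; ring
    have h₂ : G (m + 1 - k - 1) = G k := by rw [← hG.symm k]; congr 1; ring
    rw [Equiv.subLeft_apply, h₁, h₂, show j + 1 - (m + 1 - k) = j - m + k by ring,
      ← mul_neg, neg_sub]
  rw [difference, two_mul]
  nth_rewrite 2 [reflect]
  rw [← sub_eq_add_neg, ← finsum_sub_distrib (finite _) (finite _)]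
  simp only [sub_mul]

theorem convolution [LinearOrder R] [IsStrictOrderedRing R] (hF : IsSymmUnimodal F n)
    (hG : IsSymmUnimodal G m) :
    IsSymmUnimodal (fun j => ∑ᶠ k, F (j - k) * G k) (n + m) where
  eq_zero_of_neg j hj := by
    refine finsum_eq_zero_of_forall_eq_zero fun k => ?_
    obtain hk | hk := lt_or_ge k 0
    · rw [hG.eq_zero_of_neg k hk, mul_zero]
    · rw [hF.eq_zero_of_neg _ (by lia), zero_mul]
  symm j := by
    rw [← finsum_comp_equiv (Equiv.subLeft m)]
    refine finsum_congr fun k => ?_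
    rw [Equiv.subLeft_apply, hG.symm, show n + m - j - (m - k) = n - (j - k) by ring, hF.symm]
  le_succ j hj := by
    rw [← sub_nonneg, ← mul_nonneg_iff_of_pos_left (zero_lt_two' R),
      hG.two_mul_convolution_succ_sub]
    refine finsum_nonneg fun k => ?_
    obtain hk | hk := le_total (2 * k) (m + 1)
    · exact mul_nonneg (sub_nonneg.2 (hF.le_of_le_of_add_le (by lia) (by lia)))
        (sub_nonneg.2 (hG.le_of_le_of_add_le (by lia) (by lia)))
    · refine mul_nonneg_of_nonpos_of_nonpos
        (sub_nonpos.2 (hF.le_of_le_of_add_le (by lia) (by lia))) (sub_nonpos.2 ?_)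
      rw [← hG.symm k, ← hG.symm (k - 1)]
      exact hG.le_of_le_of_add_le (by lia) (by lia)

end Ring

end IsSymmUnimodal

/-- The extension by zero of a sequence on `ℕ` to one on `ℤ`. -/
noncomputable def zeroExtend {R : Type*} [Zero R] (h : ℕ → R) : ℤ → R :=
  Function.extend ((↑) : ℕ → ℤ) h fun _ => 0

lemma zeroExtend_natCast {R : Type*} [Zero R] (h : ℕ → R) (k : ℕ) : zeroExtend h k = h k :=
  Nat.cast_injective.extend_apply h _ k

lemma zeroExtend_of_neg {R : Type*} [Zero R] (h : ℕ → R) {i : ℤ} (hi : i < 0) :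
    zeroExtend h i = 0 :=
  Function.extend_apply' h _ i fun ⟨k, hk⟩ => (hk ▸ hi).not_ge k.cast_nonneg

lemma finsum_zeroExtend_mul {R : Type*} [NonUnitalNonAssocSemiring R] (f g : ℕ → R) (m : ℕ) :
    ∑ᶠ k, zeroExtend f (m - k) * zeroExtend g k = ∑ p ∈ antidiagonal m, f p.1 * g p.2 := by
  have support : (Function.support fun k => zeroExtend f (m - k) * zeroExtend g k) ⊆
      (antidiagonal m).image fun p => (p.2 : ℤ) := by
    intro k hk
    have hk0 : 0 ≤ k := by
      by_contra! h
      exact hk (by simp only [zeroExtend_of_neg g h, mul_zero])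
    have hkm : 0 ≤ m - k := by
      by_contra! h
      exact hk (by simp only [zeroExtend_of_neg f h, zero_mul])
    refine Finset.mem_coe.2 (Finset.mem_image.2 ⟨((m - k).toNat, k.toNat), ?_, ?_⟩)
    · rw [mem_antidiagonal]
      lia
    · exact Int.toNat_of_nonneg hk0
  rw [finsum_eq_sum_of_support_subset _ support, Finset.sum_image]
  · refine Finset.sum_congr rfl fun p hp => ?_
    rw [← mem_antidiagonal.1 hp, Nat.cast_add, add_sub_cancel_right, zeroExtend_natCast,
      zeroExtend_natCast]
  · intro p hp q hq hpq
    have snd_eq : p.2 = q.2 := Nat.cast_injective hpq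
    have sum_eq := (mem_antidiagonal.1 hp).trans (mem_antidiagonal.1 hq).symm
    exact Prod.ext (Nat.add_right_cancel (snd_eq ▸ sum_eq)) snd_eq

lemma zeroExtend_sum_antidiagonal {R : Type*} [NonUnitalNonAssocSemiring R] (f g : ℕ → R) :
    zeroExtend (fun m => ∑ p ∈ antidiagonal m, f p.1 * g p.2) =
      fun j => ∑ᶠ k, zeroExtend f (j - k) * zeroExtend g k := by
  ext j
  obtain hj | hj := lt_or_ge j 0
  · rw [zeroExtend_of_neg _ hj, finsum_eq_zero_of_forall_eq_zero fun k => ?_]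
    obtain hk | hk := lt_or_ge k 0
    · rw [zeroExtend_of_neg g hk, mul_zero]
    · rw [zeroExtend_of_neg f (by lia), zero_mul]
  · lift j to ℕ using hj
    rw [zeroExtend_natCast, finsum_zeroExtend_mul]

lemma isSymmUnimodal_zeroExtend {R : Type*} [Zero R] [Preorder R] {h : ℕ → R} {d : ℕ}
    (h_nonneg : 0 ≤ h 0) (h_symm : ∀ {j k}, j + k = d → h j = h k)
    (h_zero : ∀ {j}, d < j → h j = 0) (h_le : ∀ j, 2 * j + 1 ≤ d → h j ≤ h (j + 1)) :
    IsSymmUnimodal (zeroExtend h) d where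
  eq_zero_of_neg _ := zeroExtend_of_neg h
  symm i := by
    obtain hi | hi := lt_or_ge i 0
    · lift (d - i) to ℕ using (by lia) with k hk
      rw [zeroExtend_of_neg h hi, zeroExtend_natCast, h_zero (by lia)]
    · lift i to ℕ using hi
      obtain hid | hid := lt_or_ge d i
      · rw [zeroExtend_of_neg h (by lia), zeroExtend_natCast, h_zero hid]
      · rw [← Nat.cast_sub hid, zeroExtend_natCast, zeroExtend_natCast,
          h_symm (Nat.sub_add_cancel hid)]
  le_succ i hi := by
    obtain hi' | rfl | hi' := lt_trichotomy i (-1)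
    · rw [zeroExtend_of_neg h (by lia), zeroExtend_of_neg h (by lia)]
    · rw [zeroExtend_of_neg h neg_one_lt_zero, neg_add_cancel, ← Nat.cast_zero (R := ℤ),
        zeroExtend_natCast]
      exact h_nonneg
    · lift i to ℕ using (by lia)
      rw [← Nat.cast_succ, zeroExtend_natCast, zeroExtend_natCast]
      exact h_le i (by lia)

lemma exists_peak_iff {α : Type*} [Preorder α] {h : ℕ → α} {d : ℕ}
    (h_symm : ∀ {j k}, j + k = d → h j = h k) :
    (∃ k ≤ d, (∀ j < k, h j ≤ h (j + 1)) ∧ ∀ j, k ≤ j → j < d → h (j + 1) ≤ h j) ↔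
      ∀ j, 2 * j + 1 ≤ d → h j ≤ h (j + 1) := by
  have reflect {j k : ℕ} (hjk : j + k + 1 = d) : h (j + 1) ≤ h j ↔ h k ≤ h (k + 1) := by
    rw [h_symm (j := j + 1) (k := k) (by lia), h_symm (j := j) (k := k + 1) (by lia)]
  constructor
  · rintro ⟨k, -, increasing, decreasing⟩ j hj
    obtain hjk | hkj := lt_or_ge j k
    · exact increasing j hjk
    · exact (reflect (j := d - 1 - j) (by lia)).1 (decreasing _ (by lia) (by lia))
  · intro h_le
    exact ⟨d / 2, Nat.div_le_self d 2, fun j hj => h_le j (by lia),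
      fun j hj hjd => (reflect (k := d - 1 - j) (by lia)).2 (h_le _ (by lia))⟩

lemma IsSymmUnimodal.exists_peak {R : Type*} [Zero R] [Preorder R] {h : ℕ → R} {d : ℕ}
    (hF : IsSymmUnimodal (zeroExtend h) d) :
    ∃ k ≤ d, (∀ j < k, h j ≤ h (j + 1)) ∧ ∀ j, k ≤ j → j < d → h (j + 1) ≤ h j := by
  refine (exists_peak_iff fun {j k} hjk => ?_).2 fun j hj => ?_
  · rw [← zeroExtend_natCast h j, ← zeroExtend_natCast h k, ← hF.symm k, ← hjk, Nat.cast_add,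
      add_sub_cancel_right]
  · simpa only [← zeroExtend_natCast h, Nat.cast_succ] using hF.le_succ j (by lia)

end SymmetricUnimodal

section FreeSumOfReflexive

variable {ι κ : Type*} [Fintype ι] [Fintype κ] {P : Set (ι → ℝ)} {Q : Set (κ → ℝ)}

lemma IsReflexive.translate (hP : IsReflexive P) (w : ι → ℤ) :
    IsReflexive (translate P (toReal w)) := by
  obtain ⟨u, hu⟩ := hP.2
  refine ⟨hP.1.translate w, u - w, ?_⟩
  rwa [translate_translate, toReal_sub, add_sub_cancel]

lemma IsReflexive.interior_nonempty (hP : IsReflexive P) : (interior P).Nonempty := by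
  obtain ⟨u, hu⟩ := hP.exists_isCenteredReflexive
  have := hu.zero_mem_interior
  rw [interior_translate, mem_translate_iff] at this
  exact ⟨_, this⟩

lemma zero_mem_extremePoints_translate {κ : Type*} {Q : Set (κ → ℝ)} {v : κ → ℝ}
    (hv : v ∈ Q.extremePoints ℝ) : 0 ∈ (LatticePolytope.translate Q v).extremePoints ℝ := by
  refine ⟨by rw [mem_translate_iff, zero_add]; exact hv.1, fun x hx y hy h => ?_⟩
  have hmem : v ∈ openSegment ℝ (x + v) (y + v) := by
    rw [add_comm x, add_comm y]
    simpa only [add_zero] using (mem_openSegment_translate ℝ v).2 h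
  exact add_eq_right.1 (hv.2 (mem_translate_iff.1 hx) (mem_translate_iff.1 hy) hmem)

lemma IsCenteredReflexive.isReflexive_freeSum (hP : IsCenteredReflexive P) (hQ : IsReflexive Q)
    (h0 : 0 ∈ Q) : IsReflexive (freeSum P Q) := by
  obtain ⟨u, hu⟩ := hQ.exists_isCenteredReflexive
  have hmem : toReal (-u) ∈ LatticePolytope.translate Q (toReal u) := by
    rwa [mem_translate_iff, ← toReal_add, neg_add_cancel, toReal_zero]
  have h := hP.translate_freeSum hu hmem
  rw [translate_translate, ← toReal_add, add_neg_cancel, toReal_zero, translate_zero] at h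
  exact ⟨hP.isLatticePolytope.freeSum hQ.1, _, h.zero_mem_interior, h.isLatticePolytope_polarDual⟩

lemma IsReflexive.hStar_symm (hP : IsReflexive P) (hP' : IsSimplex P) {j k : ℕ}
    (hjk : j + k = Fintype.card ι) : hStar P j = hStar P k := by
  obtain ⟨u, hu⟩ := hP.exists_isCenteredReflexive
  rw [← hStar_translate u]
  exact hu.hStar_symm (hP'.translate _) hjk

lemma IsReflexive.isSymmUnimodal_hStar (hP : IsReflexive P) (hP' : IsSimplex P)
    (h : HStarUnimodal P) : IsSymmUnimodal (zeroExtend (hStar P)) (Fintype.card ι) := by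
  rw [HStarUnimodal, dim_eq_card_of_interior_nonempty hP.interior_nonempty] at h
  exact isSymmUnimodal_zeroExtend (hStar_zero P ▸ zero_le_one) (hP.hStar_symm hP')
    (hP'.hStar_eq_zero_of_card_lt hP.1 hP.interior_nonempty)
    ((exists_peak_iff (hP.hStar_symm hP')).1 h)

theorem IsCenteredReflexive.hStarUnimodal_freeSum (hP : IsCenteredReflexive P)
    (hQ : IsReflexive Q) (h0 : 0 ∈ Q)
    (hPh : IsSymmUnimodal (zeroExtend (hStar P)) (Fintype.card ι))
    (hQh : IsSymmUnimodal (zeroExtend (hStar Q)) (Fintype.card κ)) :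
    HStarUnimodal (freeSum P Q) := by
  have hStar_eq : hStar (freeSum P Q) =
      fun m => ∑ p ∈ antidiagonal m, hStar P p.1 * hStar Q p.2 :=
    funext (hP.hStar_freeSum hQ.1.convex hQ.1.isCompact h0 hQ.interior_nonempty)
  have hinterior := (hP.isReflexive_freeSum hQ h0).interior_nonempty
  rw [HStarUnimodal, dim_eq_card_of_interior_nonempty hinterior, Fintype.card_sum]
  refine IsSymmUnimodal.exists_peak ?_
  rw [hStar_eq, zeroExtend_sum_antidiagonal, Nat.cast_add]
  exact hPh.convolution hQh

end FreeSumOfReflexive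

end LatticePolytope

open LatticePolytope in
theorem corollary2p6_general {ι κ : Type*} [Fintype ι] [Fintype κ] {P : Set (ι → ℝ)}
    {Q : Set (κ → ℝ)} (hP : IsReflexive P) (hQ : IsReflexive Q) (h0 : 0 ∈ interior P)
    {v : κ → ℤ} (hv : toReal v ∈ Q) :
    IsReflexive (star P Q (toReal v)) ∧
    (IsIntegrallyClosed P → IsIntegrallyClosed Q →
      IsIntegrallyClosed (star P Q (toReal v))) ∧
    (IsSimplex P → IsSimplex Q →
      (toReal v ∈ Q.extremePoints ℝ → IsSimplex (star P Q (toReal v))) ∧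
      (HStarUnimodal P → HStarUnimodal Q → HStarUnimodal (star P Q (toReal v)))) := by
  have hP₀ := hP.isCenteredReflexive h0
  have hQ' := hQ.translate v
  have h0' : 0 ∈ translate Q (toReal v) := by rwa [mem_translate_iff, zero_add]
  rw [star_eq_freeSum]
  refine ⟨hP₀.isReflexive_freeSum hQ' h0',
    fun hPc hQc => hP₀.isIntegrallyClosed_freeSum h0' hPc (hQc.translate v),
    fun hPs hQs => ⟨fun hv' => ?_, fun hPh hQh => ?_⟩⟩
  · exact hPs.freeSum hP₀.zero_mem (hQs.translate _) (zero_mem_extremePoints_translate hv')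
  · exact hP₀.hStarUnimodal_freeSum hQ' h0' (hP.isSymmUnimodal_hStar hPs hPh)
      (hQ'.isSymmUnimodal_hStar (hQs.translate _) ((hStarUnimodal_translate_iff v).2 hQh))

theorem corollary2p6 {ι κ : Type*} [Fintype ι] [Fintype κ]
    (P : Set (ι → ℝ)) (Q : Set (κ → ℝ))
    (hP : LatticePolytope.IsSimplex P) (hQ : LatticePolytope.IsSimplex Q)
    (hPr : LatticePolytope.IsReflexive P) (hQr : LatticePolytope.IsReflexive Q)
    (hPc : LatticePolytope.IsIntegrallyClosed P) (hQc : LatticePolytope.IsIntegrallyClosed Q)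
    (h0 : (0 : ι → ℝ) ∈ interior P)
    (v : κ → ℝ) (hv : v ∈ Q.extremePoints ℝ) :
    (LatticePolytope.IsSimplex (LatticePolytope.star P Q v) ∧
      LatticePolytope.IsReflexive (LatticePolytope.star P Q v) ∧
      LatticePolytope.IsIntegrallyClosed (LatticePolytope.star P Q v)) ∧
    (LatticePolytope.HStarUnimodal P → LatticePolytope.HStarUnimodal Q →
      LatticePolytope.HStarUnimodal (LatticePolytope.star P Q v)) := by
  obtain ⟨w, rfl⟩ := hQr.1.exists_eq_toReal_of_mem_extremePoints hv
  obtain ⟨reflexive, closed, simplex⟩ := corollary2p6_general hPr hQr h0 hv.1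
  obtain ⟨simplex, unimodal⟩ := simplex hP hQ
  exact ⟨⟨simplex hv, reflexive, closed hPc hQc⟩, unimodal⟩
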